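/- Let $p$ be a prime, let $k$ be a perfect field of characteristic $p$ with algebraic closure $\bar k$, and let $Y$ and $Z$ be schemes of finite type over $k$, with $Y$ reduced and $Z$ normal (every local ring of $Z$ is an integrally closed domain). Let $f\colon Y\to Z$ be a proper morphism of $k$-schemes that is a bijection on geometric points, i.e. the induced map $Y(\bar k)\to Z(\bar k)$ is bijective. (This holds in particular if $Y(K)\to Z(K)$ is bijective for every perfect field $K$ containing $k$.) Then $f$ is a Frobenius factor: there exist an integer $r\ge 0$ and a morphism of $k$-schemes $f'\colon Z_{p^r}\to Y$ such that $f\circ f'\colon Z_{p^r}\to Z$ is the $r$-th power of the Frobenius morphism. Here $Z_{p^r}$ denotes the $k$-scheme obtained from $Z$ by composing its structure map $Z\to\operatorname{Spec}k$ with the $p^r$-th power Frobenius automorphism of $\operatorname{Spec}k$, and the $r$-th power of the Frobenius morphism is the $k$-morphism $Z_{p^r}\to Z$ which is the identity on the underlying space and $s\mapsto s^{p^r}$ on sections of the structure sheaf. -/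

import Mathlib

open CategoryTheory AlgebraicGeometry

universe u

namespace FrobeniusFactor

/-- The `p`-power ring endomorphism `x ↦ x ^ p` of a commutative ring in which the prime `p` is
zero. (The zero ring is allowed, since it occurs as a ring of sections.) -/
def powHom (p : ℕ) [Fact p.Prime] (R : Type u) [CommRing R] (h : (p : R) = 0) : R →+* R where
  toFun x := x ^ p
  map_one' := one_pow p
  map_mul' x y := mul_pow x y p
  map_zero' := zero_pow (Fact.out : p.Prime).ne_zero
  map_add' x y := by
    obtain ⟨r, hr⟩ := exists_add_pow_prime_eq (Fact.out : p.Prime) x y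
    rw [hr, h]; ring

/-- A scheme has characteristic `p` if `p = 0` in its ring of global functions. -/
def HasChar (p : ℕ) (X : Scheme.{u}) : Prop := (p : Γ(X, ⊤)) = 0

theorem HasChar.section_eq_zero {p : ℕ} {X : Scheme.{u}} (h : HasChar p X) (U : X.Opens) :
    (p : Γ(X, U)) = 0 := by
  have := congrArg (X.presheaf.map (homOfLE (le_top : U ≤ ⊤)).op).hom h
  simpa using this

/-- The absolute Frobenius as a morphism of presheafed spaces: the identity on the underlying
space and `s ↦ s ^ p` on sections of the structure sheaf. -/
noncomputable def absoluteFrobeniusAux (p : ℕ) [Fact p.Prime] (X : Scheme.{u}) (h : HasChar p X) :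
    X.toPresheafedSpace.Hom X.toPresheafedSpace where
  base := 𝟙 _
  c :=
    { app := fun U => CommRingCat.ofHom (powHom p Γ(X, U.unop) (h.section_eq_zero U.unop))
      naturality := fun U V i => by
        ext s
        exact (map_pow (X.presheaf.map i).hom s p).symm }

/-- The absolute Frobenius endomorphism of a scheme of characteristic `p`: the identity on the
underlying space and `s ↦ s ^ p` on sections of the structure sheaf. -/
noncomputable def absoluteFrobenius (p : ℕ) [Fact p.Prime] (X : Scheme.{u}) (h : HasChar p X) :
    X ⟶ X where
  toHom := absoluteFrobeniusAux p X h
  prop x := by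
    constructor
    intro a ha
    obtain ⟨U, hx, s, rfl⟩ := X.presheaf.exists_germ_eq a
    have key := congrArg (fun g => g.hom s)
      (PresheafedSpace.stalkMap_germ (absoluteFrobeniusAux p X h) U x hx)
    have key2 : ((absoluteFrobeniusAux p X h).stalkMap x).hom
        ((X.presheaf.germ U x hx).hom s) = (X.presheaf.germ U x hx).hom (s ^ p) := key
    have ha2 : IsUnit ((X.presheaf.germ U x hx).hom (s ^ p)) := key2 ▸ ha
    rw [map_pow, isUnit_pow_iff (Fact.out : p.Prime).ne_zero] at ha2
    exact ha2

theorem absoluteFrobenius_apply (p : ℕ) [Fact p.Prime] (X : Scheme.{u}) (h : HasChar p X) (x : X) :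
    absoluteFrobenius p X h x = x := rfl

theorem absoluteFrobenius_app (p : ℕ) [Fact p.Prime] (X : Scheme.{u}) (h : HasChar p X)
    (U : X.Opens) (s : Γ(X, U)) : (absoluteFrobenius p X h).app U s = s ^ p := rfl

/-- The `r`-fold iterate of the absolute Frobenius endomorphism. -/
noncomputable def iteratedFrobenius (p : ℕ) [Fact p.Prime] (X : Scheme.{u}) (h : HasChar p X) :
    ℕ → (X ⟶ X)
  | 0 => 𝟙 X
  | r + 1 => iteratedFrobenius p X h r ≫ absoluteFrobenius p X h

theorem iteratedFrobenius_appTop (p : ℕ) [Fact p.Prime] (X : Scheme.{u}) (h : HasChar p X)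
    (r : ℕ) (s : Γ(X, ⊤)) : (iteratedFrobenius p X h r).appTop s = s ^ p ^ r := by
  induction r generalizing s with
  | zero => simp [iteratedFrobenius]
  | succ r ih =>
    have h1 : (iteratedFrobenius p X h (r + 1)).appTop s =
      (iteratedFrobenius p X h r).appTop ((absoluteFrobenius p X h).appTop s) := rfl
    have h2 : (absoluteFrobenius p X h).appTop s = s ^ p := rfl
    rw [h1, h2, ih, ← pow_mul, pow_succ']

/-- A scheme over a field of characteristic `p` has characteristic `p`. -/
theorem hasChar_of_over (p : ℕ) {k : Type u} [Field k] [CharP k p] (Z : Over (Spec (.of k))) : HasChar p Z.left := by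
  have h : (p : Γ(Spec (.of k), ⊤)) = 0 := by
    rw [← map_natCast (Scheme.ΓSpecIso (.of k)).inv.hom p]
    exact (congrArg _ (CharP.cast_eq_zero k p)).trans (map_zero _)
  unfold HasChar
  rw [← map_natCast Z.hom.appTop.hom p, h]
  exact map_zero _

/-- The morphism `Spec k ⟶ Spec k` given by the `p ^ r`-th power Frobenius `a ↦ a ^ p ^ r` of the
field `k`. It is an automorphism when `k` is perfect. -/
noncomputable def baseFrobenius (p : ℕ) [Fact p.Prime] (k : Type u) [Field k] [CharP k p] (r : ℕ) :
    Spec (.of k) ⟶ Spec (.of k) :=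
  Spec.map (CommRingCat.ofHom (iterateFrobenius k p r))

/-- The `k`-scheme `Z_{p ^ r}`: the same scheme as `Z`, with the structure morphism composed with
the `p ^ r`-th power Frobenius of `Spec k`. -/
noncomputable def frobeniusTwist (p : ℕ) [Fact p.Prime] {k : Type u} [Field k] [CharP k p]
    (Z : Over (Spec (.of k))) (r : ℕ) : Over (Spec (.of k)) :=
  Over.mk (Z.hom ≫ baseFrobenius p k r)

/-- The `r`-th power of the Frobenius morphism, as a morphism of `k`-schemes `Z_{p ^ r} ⟶ Z`. -/
noncomputable def frobeniusPower (p : ℕ) [Fact p.Prime] {k : Type u} [Field k] [CharP k p]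
    (Z : Over (Spec (.of k))) (r : ℕ) : frobeniusTwist p Z r ⟶ Z :=
  Over.homMk (iteratedFrobenius p Z.left (hasChar_of_over p Z) r) (by
    refine ext_of_isAffine ?_
    ext s
    have h1 : (iteratedFrobenius p Z.left (hasChar_of_over p Z) r ≫ Z.hom).appTop s =
      (iteratedFrobenius p Z.left (hasChar_of_over p Z) r).appTop (Z.hom.appTop s) := rfl
    have h2 : (Z.hom ≫ baseFrobenius p k r).appTop s =
      Z.hom.appTop ((baseFrobenius p k r).appTop s) := rfl
    have h3 : (baseFrobenius p k r).appTop s = s ^ p ^ r := by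
      apply (Scheme.ΓSpecIso (.of k)).commRingCatIsoToRingEquiv.injective
      have := congrArg (fun g => g.hom s) (Scheme.ΓSpecIso_naturality
        (CommRingCat.ofHom (iterateFrobenius k p r)))
      rw [map_pow]
      exact this
    change _ = (Z.hom ≫ baseFrobenius p k r).appTop s
    refine h1.trans ?_
    rw [iteratedFrobenius_appTop, h2, h3, map_pow])

/-- A morphism `f : Y ⟶ Z` of `k`-schemes is a Frobenius factor if, for some `r`, there is a
morphism of `k`-schemes `f' : Z_{p ^ r} ⟶ Y` such that `f ∘ f'` is the `r`-th power of the
Frobenius morphism `Z_{p ^ r} ⟶ Z`. -/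
def IsFrobeniusFactor (p : ℕ) [Fact p.Prime] {k : Type u} [Field k] [CharP k p]
    {Y Z : Over (Spec (.of k))} (f : Y ⟶ Z) : Prop :=
  ∃ (r : ℕ) (f' : frobeniusTwist p Z r ⟶ Y), f' ≫ f = frobeniusPower p Z r

/-- A scheme is normal if all its local rings are integrally closed domains. -/
class IsNormal (X : Scheme.{u}) : Prop where
  isDomain_stalk : ∀ x : X, IsDomain (X.presheaf.stalk x)
  isIntegrallyClosed_stalk : ∀ x : X, IsIntegrallyClosed (X.presheaf.stalk x)

/-- The geometric point `Spec k̄`, as a `k`-scheme. -/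
noncomputable def geometricPoint (k : Type u) [Field k] : Over (Spec (.of k)) :=
  Over.mk (Spec.map (CommRingCat.ofHom (algebraMap k (AlgebraicClosure k))))

/-- A morphism `f : Y ⟶ Z` of `k`-schemes is a bijection on (geometric) points if the induced map
`Y(k̄) → Z(k̄)` is bijective. -/
def BijectiveOnPoints {k : Type u} [Field k] {Y Z : Over (Spec (.of k))} (f : Y ⟶ Z) : Prop :=
  Function.Bijective fun y : geometricPoint k ⟶ Y => y ≫ f

end FrobeniusFactor

/-! The theorem holds because `f` is a finite universal homeomorphism, which over a normal base is
generically purely inseparable and hence inverted by a power of Frobenius.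

Closed points are dense in schemes of finite type over `k`, and each of them underlies a `k̄`-point.
Applied to `f`, this gives surjectivity (`BijectiveOnPoints.surjective`). Applied to the diagonal
`Y ⟶ Y ×[Z] Y`, a closed immersion, it gives surjectivity of the diagonal, that is, universal
injectivity of `f` (`BijectiveOnPoints.universallyInjective`). So `f` is proper and quasi-finite,
and by Zariski's main theorem it is finite.

Since `Z` is locally noetherian and normal, it is covered by affine opens `Spec A` with `A` an
integrally closed domain. The preimage of such an open is `Spec B` with `B` reduced and finite over
`A`. As `Spec B ⟶ Spec A` is bijective and injective on field-valued points, `B` is a domain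
containing `A`, and the extension of fraction fields is finite and purely inseparable. It follows
that `b ^ p ^ r` lies in `Frac A` for a uniform `r`; being integral over `A`, it lies in `A`
(`exists_pow_mem_range`). The ring homomorphism `B → A`, `b ↦ b ^ p ^ r`, is the required lift of
Frobenius over `Spec A`.

Finally `Z` is quasi-compact, so one `r` serves a whole cover. Lifts from a reduced scheme along a
separated universally injective morphism are unique (`eq_of_comp_eq_of_universallyInjective`), so
the local lifts glue. Compatibility with the structure maps to `Spec k` follows from that of `f` and
of Frobenius. -/

namespace FrobeniusFactor

open Limits

/-! ### Finite extensions of integrally closed domains -/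

section Algebra

variable {A B : Type u} [CommRing A] [CommRing B] [Algebra A B]

/-- The prime over `0` lies, by going up and injectivity on spectra, in every prime of `B`. -/
theorem isDomain_of_comap_bijective [IsDomain A] [IsReduced B] [Algebra.IsIntegral A B]
    (h : Function.Bijective (PrimeSpectrum.comap (algebraMap A B))) :
    IsDomain B ∧ Function.Injective (algebraMap A B) := by
  obtain ⟨q, hq⟩ := h.2 ⟨⊥, Ideal.isPrime_bot⟩
  have hq' : q.asIdeal.comap (algebraMap A B) = ⊥ := congrArg PrimeSpectrum.asIdeal hq
  have hbot : q.asIdeal = ⊥ := by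
    refine eq_bot_iff.mpr fun b hb => ?_
    refine (mem_nilradical.mp ?_ : IsNilpotent b).eq_zero
    rw [nilradical_eq_sInf]
    refine Ideal.mem_sInf.mpr fun {P} hP => ?_
    have hP' : P.IsPrime := hP
    obtain ⟨Q, hQ, hQp, hQP⟩ := Ideal.exists_ideal_over_prime_of_isIntegral
      (P.comap (algebraMap A B)) q.asIdeal (by rw [hq']; exact bot_le)
    have : (⟨Q, hQp⟩ : PrimeSpectrum B) = ⟨P, hP'⟩ := h.1 (PrimeSpectrum.ext hQP)
    obtain rfl : Q = P := congrArg PrimeSpectrum.asIdeal this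
    exact hQ hb
  refine ⟨have : (⊥ : Ideal B).IsPrime := hbot ▸ q.isPrime; IsDomain.of_bot_isPrime B, ?_⟩
  rw [RingHom.injective_iff_ker_eq_bot, RingHom.ker_eq_comap_bot, ← hbot, hq']

/-- If `Spec B ⟶ Spec A` is injective on field-valued points, then `Frac B` has a single embedding
over `Frac A` into its algebraic closure. -/
theorem isPurelyInseparable_fractionRing [IsDomain A] [IsDomain B]
    (K L : Type u) [Field K] [Field L] [Algebra A K] [IsFractionRing A K]
    [Algebra B L] [IsFractionRing B L] [Algebra K L] [Algebra A L] [IsScalarTower A K L]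
    [IsScalarTower A B L]
    (h : ∀ (Ω : Type u) [Field Ω] (g₁ g₂ : B →+* Ω),
      g₁.comp (algebraMap A B) = g₂.comp (algebraMap A B) → g₁ = g₂) :
    IsPurelyInseparable K L := by
  rw [isPurelyInseparable_iff_subsingleton_emb]
  refine ⟨fun σ₁ σ₂ => AlgHom.coe_ringHom_injective (IsLocalization.ringHom_ext
    (nonZeroDivisors B) (h _ _ _ (RingHom.ext fun a => ?_)))⟩
  have hc (σ : Field.Emb K L) :
      σ (algebraMap B L (algebraMap A B a)) =
        algebraMap K (AlgebraicClosure L) (algebraMap A K a) := by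
    rw [← IsScalarTower.algebraMap_apply A B L, IsScalarTower.algebraMap_apply A K L, σ.commutes]
  exact (hc σ₁).trans (hc σ₂).symm

/-- A power `b ^ p ^ r` in the fraction field of `A` is integral over `A`, so it lies in `A`. The
exponent is uniform because the extension of fraction fields is finite, and every larger exponent
works as well. -/
theorem exists_pow_mem_range (p : ℕ) [Fact p.Prime] (hp : (p : A) = 0)
    [IsDomain A] [IsIntegrallyClosed A] [IsReduced B] [Module.Finite A B]
    (hbij : Function.Bijective (PrimeSpectrum.comap (algebraMap A B)))
    (h : ∀ (Ω : Type u) [Field Ω] (g₁ g₂ : B →+* Ω),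
      g₁.comp (algebraMap A B) = g₂.comp (algebraMap A B) → g₁ = g₂) :
    ∃ n : ℕ, ∀ r, n ≤ r → ∀ b : B, b ^ p ^ r ∈ (algebraMap A B).range := by
  obtain ⟨_, hinj⟩ := isDomain_of_comap_bijective hbij
  have : FaithfulSMul A B := (faithfulSMul_iff_algebraMap_injective A B).mpr hinj
  let K := FractionRing A
  let L := FractionRing B
  let : Algebra K L := FractionRing.liftAlgebra A L
  have : IsPurelyInseparable K L := isPurelyInseparable_fractionRing (A := A) (B := B) K L h
  have : CharP A p := (CharP.charP_iff_prime_eq_zero Fact.out).mpr hp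
  have : CharP K p := IsFractionRing.charP A p
  have : Module.Finite K L := .of_isLocalization A B (nonZeroDivisors A)
  refine ⟨IsPurelyInseparable.exponent K L, fun r hr b => ?_⟩
  obtain ⟨x, hx⟩ := IsPurelyInseparable.exponent_def' K p (algebraMap B L b)
  obtain ⟨s, rfl⟩ := Nat.exists_eq_add_of_le hr
  have hx' : algebraMap K L (x ^ p ^ s) =
      algebraMap B L (b ^ p ^ (IsPurelyInseparable.exponent K L + s)) := by
    rw [map_pow, hx, map_pow, ← pow_mul, pow_add]
  have hint : IsIntegral A (x ^ p ^ s) := by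
    rw [← isIntegral_algebraMap_iff (algebraMap K L).injective, hx']
    exact (Algebra.IsIntegral.isIntegral _).algebraMap
  obtain ⟨a, ha⟩ := IsIntegrallyClosed.isIntegral_iff.mp hint
  refine ⟨a, FaithfulSMul.algebraMap_injective B L ?_⟩
  rw [← hx', ← ha, ← IsScalarTower.algebraMap_apply, ← IsScalarTower.algebraMap_apply]

end Algebra

/-- If `A ⊆ B` and `A` contains all `p ^ r`-th powers of `B`, then `b ↦ b ^ p ^ r` is a ring
homomorphism `B → A` that restricts to the `p ^ r`-th power Frobenius of `A`. -/
theorem exists_ringHom_comp_eq_pow {A B : Type u} [CommRing A] [CommRing B] (φ : A →+* B)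
    (hφ : Function.Injective φ) (p r : ℕ) [Fact p.Prime] (hp : (p : A) = 0)
    (h : ∀ b : B, b ^ p ^ r ∈ φ.range) :
    ∃ ψ : B →+* A, ∀ a, ψ (φ a) = a ^ p ^ r := by
  choose g hg using h
  have hpB : (p : B) = 0 := by rw [← map_natCast φ, hp, map_zero]
  have hadd : ∀ x y : B, (x + y) ^ p ^ r = x ^ p ^ r + y ^ p ^ r := by
    intro x y
    obtain ⟨c, hc⟩ := exists_add_pow_prime_pow_eq (Fact.out : p.Prime) x y r
    rw [hc, hpB]; ring
  exact ⟨{ toFun := g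
           map_one' := hφ (by rw [hg, one_pow, map_one])
           map_mul' := fun x y => hφ (by rw [hg, mul_pow, map_mul, hg, hg])
           map_zero' := hφ (by
            rw [hg, map_zero, zero_pow (pow_ne_zero _ (Fact.out : p.Prime).ne_zero)])
           map_add' := fun x y => hφ (by rw [hg, hadd, map_add, hg, hg]) },
    fun a => hφ ((hg _).trans (map_pow φ a _).symm)⟩

/-! ### From geometric points to universal injectivity -/

/-- Every closed point of a scheme locally of finite type over `k` has finite residue field over
`k`, so it is the image of a `k̄`-point. -/
theorem exists_geometricPoint {k : Type u} [Field k] {X : Scheme.{u}} (s : X ⟶ Spec (.of k))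
    [LocallyOfFiniteType s] (x : X) (hx : IsClosed {x}) :
    ∃ g : Spec (.of (AlgebraicClosure k)) ⟶ X,
      g ≫ s = Spec.map (CommRingCat.ofHom (algebraMap k (AlgebraicClosure k))) ∧
        x ∈ Set.range g := by
  have : JacobsonSpace X := LocallyOfFiniteType.jacobsonSpace s
  have := isClosed_singleton_iff_isClosedImmersion.mp hx
  have : IsFinite (X.fromSpecResidueField x ≫ s) :=
    isFinite_iff_locallyOfFiniteType_of_jacobsonSpace.mpr inferInstance
  obtain ⟨φ, hφ⟩ := Spec.map_surjective (X.fromSpecResidueField x ≫ s)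
  rw [← hφ, IsFinite.SpecMap_iff] at this
  let _ : Algebra k (X.residueField x) := φ.hom.toAlgebra
  have : Module.Finite k (X.residueField x) := ‹φ.hom.Finite›
  let σ : X.residueField x →ₐ[k] AlgebraicClosure k := IsAlgClosed.lift
  refine ⟨Spec.map (CommRingCat.ofHom σ.toRingHom) ≫ X.fromSpecResidueField x, ?_, ?_⟩
  · rw [Category.assoc, ← hφ, ← Spec.map_comp]
    exact congrArg Spec.map (CommRingCat.hom_ext σ.comp_algebraMap)
  · let t : Spec (.of (AlgebraicClosure k)) := IsLocalRing.closedPoint (AlgebraicClosure k)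
    exact ⟨t, by rw [Scheme.Hom.comp_apply, X.fromSpecResidueField_apply]⟩

/-- In a scheme locally of finite type over `k` the closed points are dense, so a morphism with
closed image that reaches all `k̄`-points is surjective. -/
theorem surjective_of_lift_geometricPoint {k : Type u} [Field k] {W X : Scheme.{u}}
    (s : X ⟶ Spec (.of k)) [LocallyOfFiniteType s] (f : W ⟶ X) (hcl : IsClosed (Set.range f))
    (h : ∀ g : (geometricPoint k).left ⟶ X, g ≫ s = (geometricPoint k).hom →
      ∃ g' : (geometricPoint k).left ⟶ W, g' ≫ f = g) : Surjective f := by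
  have : JacobsonSpace X := LocallyOfFiniteType.jacobsonSpace s
  refine ⟨Set.range_eq_univ.mp (Set.univ_subset_iff.mp ?_)⟩
  rw [← closure_closedPoints]
  refine closure_minimal (fun x hx => ?_) hcl
  obtain ⟨g, hg, t, rfl⟩ := exists_geometricPoint s x hx
  obtain ⟨g', rfl⟩ := h g hg
  exact ⟨g' t, rfl⟩

section

variable {k : Type u} [Field k] {Y Z : Over (Spec (.of k))} (f : Y ⟶ Z)

theorem BijectiveOnPoints.surjective [LocallyOfFiniteType Z.hom] [IsProper f.left]
    (hf : BijectiveOnPoints f) : Surjective f.left := by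
  refine surjective_of_lift_geometricPoint Z.hom f.left f.left.isClosedMap.isClosed_range
    fun g hg => ?_
  obtain ⟨y, hy⟩ := hf.2 (Over.homMk g hg)
  exact ⟨y.left, congrArg CommaMorphism.left hy⟩

/-- The diagonal of `f` is a closed immersion, and it reaches every `k̄`-point of `Y ×[Z] Y` because
`f` is injective on `k̄`-points. Hence it is surjective. -/
theorem BijectiveOnPoints.universallyInjective [LocallyOfFiniteType Y.hom] [IsProper f.left]
    (hf : BijectiveOnPoints f) : UniversallyInjective f.left := by
  rw [UniversallyInjective.iff_diagonal]
  refine surjective_of_lift_geometricPoint (pullback.fst f.left f.left ≫ Y.hom) _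
    (pullback.diagonal f.left).isClosedEmbedding.isClosed_range fun g hg => ?_
  have hsnd : pullback.snd f.left f.left ≫ Y.hom = pullback.fst f.left f.left ≫ Y.hom := by
    rw [← Over.w f, ← pullback.condition_assoc]
  let a : geometricPoint k ⟶ Y := Over.homMk (g ≫ pullback.fst f.left f.left) (by simpa using hg)
  let b : geometricPoint k ⟶ Y := Over.homMk (g ≫ pullback.snd f.left f.left) (by
    rw [Category.assoc, hsnd]; exact hg)
  have hab : a = b := hf.1 (Over.OverMorphism.ext (by
    simp [a, b, pullback.condition]))
  have hab' : g ≫ pullback.fst f.left f.left = g ≫ pullback.snd f.left f.left :=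
    congrArg CommaMorphism.left hab
  exact ⟨g ≫ pullback.fst f.left f.left, by ext <;> simp [hab']⟩

end

/-! ### Uniqueness and gluing of lifts -/

theorem eq_of_comp_eq_of_field {Y Z : Scheme.{u}} (f : Y ⟶ Z) [UniversallyInjective f]
    {Ω : Type u} [Field Ω] {g₁ g₂ : Spec (.of Ω) ⟶ Y} (h : g₁ ≫ f = g₂ ≫ f) : g₁ = g₂ := by
  have H : ∀ (K : Type u) [Field K], Function.Injective fun g : Spec (.of K) ⟶ Y => g ≫ f :=
    ((tfae_universallyInjective f).out 0 1).mp ‹_›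
  exact H Ω h

/-- A separated universally injective morphism behaves as a monomorphism on reduced sources. This is
the uniqueness that makes local lifts agree on overlaps. -/
theorem eq_of_comp_eq_of_universallyInjective {W Y Z : Scheme.{u}} [IsReduced W] (f : Y ⟶ Z)
    [IsSeparated f] [UniversallyInjective f] {g₁ g₂ : W ⟶ Y} (h : g₁ ≫ f = g₂ ≫ f) : g₁ = g₂ := by
  refine ext_of_fromSpecResidueField_eq g₁ g₂ f Set.univ dense_univ (fun x _ => ?_) h
  exact eq_of_comp_eq_of_field f (Ω := W.residueField x) (by
    rw [Category.assoc, Category.assoc, h])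

/-- Existence of a lift of `h` along `f` is local on the source, because lifts are unique. -/
theorem exists_hom_comp_eq {W Y Z : Scheme.{u}} [IsReduced W] (f : Y ⟶ Z)
    [IsSeparated f] [UniversallyInjective f] (h : W ⟶ Z) (𝒰 : W.OpenCover)
    (H : ∀ i, ∃ g : 𝒰.X i ⟶ Y, g ≫ f = 𝒰.f i ≫ h) : ∃ g : W ⟶ Y, g ≫ f = h := by
  choose g hg using H
  have hcompat (i j) :
      pullback.fst (𝒰.f i) (𝒰.f j) ≫ g i = pullback.snd (𝒰.f i) (𝒰.f j) ≫ g j := by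
    have : IsReduced (pullback (𝒰.f i) (𝒰.f j)) :=
      isReduced_of_isOpenImmersion (pullback.fst (𝒰.f i) (𝒰.f j) ≫ 𝒰.f i)
    refine eq_of_comp_eq_of_universallyInjective f ?_
    rw [Category.assoc, Category.assoc, hg, hg, pullback.condition_assoc]
  refine ⟨𝒰.glueMorphisms g hcompat, 𝒰.hom_ext _ _ fun i => ?_⟩
  rw [Scheme.Cover.ι_glueMorphisms_assoc, hg]

/-! ### Normal schemes -/

theorem IsNormal.isReduced {Z : Scheme.{u}} [IsNormal Z] : IsReduced Z := by
  have (x : Z) : _root_.IsReduced (Z.presheaf.stalk x) :=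
    have := IsNormal.isDomain_stalk x
    inferInstance
  exact isReduced_of_isReduced_stalk Z

/-- On a locally noetherian scheme the sections over a small affine neighbourhood of `z` embed into
the stalk at `z`, so they form a domain when the scheme is normal. -/
theorem IsNormal.exists_isAffineOpen {Z : Scheme.{u}} [IsLocallyNoetherian Z] [IsNormal Z] (z : Z) :
    ∃ U : Z.Opens, z ∈ U ∧ IsAffineOpen U ∧ IsDomain Γ(Z, U) ∧ IsIntegrallyClosed Γ(Z, U) := by
  obtain ⟨U, hz, hU, hinj⟩ := Z.exists_germ_injective z
  have := IsNormal.isDomain_stalk z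
  have hdom : IsDomain Γ(Z, U) := hinj.isDomain (Z.presheaf.germ U z hz).hom
  refine ⟨U, hz, hU, hdom, IsIntegrallyClosed.of_localization_maximal fun P _ _ => ?_⟩
  let y : PrimeSpectrum Γ(Z, U) := ⟨P, inferInstance⟩
  have hy : hU.fromSpec y ∈ U := by
    have : hU.fromSpec y ∈ Set.range hU.fromSpec := ⟨y, rfl⟩
    rwa [hU.range_fromSpec] at this
  let := TopCat.Presheaf.algebra_section_stalk Z.presheaf (⟨hU.fromSpec y, hy⟩ : U)
  have hloc : IsLocalization.AtPrime (Z.presheaf.stalk (hU.fromSpec y)) P :=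
    hU.isLocalization_stalk' y hy
  have := IsNormal.isIntegrallyClosed_stalk (hU.fromSpec y)
  exact .of_equiv (IsLocalization.algEquiv P.primeCompl
    (Z.presheaf.stalk (hU.fromSpec y)) (Localization.AtPrime P)).toRingEquiv

/-! ### Frobenius lifts along finite universal homeomorphisms -/

section Local

variable {Y Z : Scheme.{u}} (f : Y ⟶ Z) {U : Z.Opens}

theorem bijective_comap_app [Surjective f] [UniversallyInjective f] (hU : IsAffineOpen U)
    (hV : IsAffineOpen (f ⁻¹ᵁ U)) :
    Function.Bijective (PrimeSpectrum.comap (f.app U).hom) := by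
  have hcomm : Spec.map (f.app U) ≫ hU.fromSpec = hV.fromSpec ≫ f := by
    rw [← IsAffineOpen.SpecMap_appLE_fromSpec f hU hV le_rfl, Scheme.Hom.appLE_eq_app]
  have hcomm' (q) : hU.fromSpec (Spec.map (f.app U) q) = f (hV.fromSpec q) := by
    rw [← Scheme.Hom.comp_apply, hcomm, Scheme.Hom.comp_apply]
  change Function.Bijective (Spec.map (f.app U))
  refine ⟨fun q₁ q₂ h => ?_, fun P => ?_⟩
  · apply hV.fromSpec.isOpenEmbedding.injective
    apply f.injective
    rw [← hcomm', ← hcomm', h]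
  · obtain ⟨y, hy⟩ := f.surjective (hU.fromSpec P)
    have hyV : y ∈ Set.range hV.fromSpec := by
      rw [hV.range_fromSpec]
      change f y ∈ U
      rw [hy, ← SetLike.mem_coe, ← hU.range_fromSpec]
      exact ⟨P, rfl⟩
    obtain ⟨q, rfl⟩ := hyV
    exact ⟨q, hU.fromSpec.isOpenEmbedding.injective ((hcomm' q).trans hy)⟩

theorem ringHom_ext_of_universallyInjective [UniversallyInjective f] (hU : IsAffineOpen U)
    (hV : IsAffineOpen (f ⁻¹ᵁ U)) (Ω : Type u) [Field Ω] (g₁ g₂ : Γ(Y, f ⁻¹ᵁ U) →+* Ω)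
    (h : g₁.comp (f.app U).hom = g₂.comp (f.app U).hom) : g₁ = g₂ := by
  have hcomm : Spec.map (f.app U) ≫ hU.fromSpec = hV.fromSpec ≫ f := by
    rw [← IsAffineOpen.SpecMap_appLE_fromSpec f hU hV le_rfl, Scheme.Hom.appLE_eq_app]
  have key (g : Γ(Y, f ⁻¹ᵁ U) →+* Ω) : (Spec.map (CommRingCat.ofHom g) ≫ hV.fromSpec) ≫ f =
      Spec.map (CommRingCat.ofHom (g.comp (f.app U).hom)) ≫ hU.fromSpec := by
    rw [Category.assoc, ← hcomm, ← Spec.map_comp_assoc]; rfl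
  have := eq_of_comp_eq_of_field f (((key g₁).trans (by rw [h])).trans (key g₂).symm)
  rw [cancel_mono] at this
  exact congrArg CommRingCat.Hom.hom (Spec.map_injective this)

theorem iteratedFrobenius_preimage (p : ℕ) [Fact p.Prime] (X : Scheme.{u}) (h : HasChar p X)
    (r : ℕ) (U : X.Opens) : iteratedFrobenius p X h r ⁻¹ᵁ U = U := by
  induction r with
  | zero => rfl
  | succ r ih => exact ih

theorem iteratedFrobenius_appLE (p : ℕ) [Fact p.Prime] (X : Scheme.{u}) (h : HasChar p X)
    (r : ℕ) (U : X.Opens) (s : Γ(X, U)) :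
    (iteratedFrobenius p X h r).appLE U U (iteratedFrobenius_preimage p X h r U).ge s =
      s ^ p ^ r := by
  induction r generalizing s with
  | zero =>
    have h0 : (𝟙 X : X ⟶ X).appLE U U le_rfl = 𝟙 _ :=
      (Category.id_comp _).trans (X.presheaf.map_id _)
    exact (congrArg (fun g => g.hom s) h0).trans (pow_one s).symm
  | succ r ih =>
    have h1 : (iteratedFrobenius p X h (r + 1)).appLE U U
        (iteratedFrobenius_preimage p X h (r + 1) U).ge s =
        (iteratedFrobenius p X h r).appLE U U
          (iteratedFrobenius_preimage p X h r U).ge ((absoluteFrobenius p X h).app U s) := by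
      simp only [iteratedFrobenius, Scheme.Hom.appLE, Scheme.Hom.comp_app]
      rfl
    rw [h1, absoluteFrobenius_app, ih, ← pow_mul, pow_succ']

/-- Over an affine open `U` with integrally closed domain of sections, all large powers of Frobenius
lift along `f`. The statement covers every large `r` so that finitely many opens can share one. -/
theorem exists_lift_iteratedFrobenius_of_isAffineOpen (p : ℕ) [Fact p.Prime]
    (hZ : HasChar p Z) [IsReduced Y] [IsFinite f]
    [Surjective f] [UniversallyInjective f]
    (hU : IsAffineOpen U) [IsDomain Γ(Z, U)] [IsIntegrallyClosed Γ(Z, U)] :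
    ∃ n : ℕ, ∀ r, n ≤ r → ∃ g : U.toScheme ⟶ Y, g ≫ f = U.ι ≫ iteratedFrobenius p Z hZ r := by
  have hV : IsAffineOpen (f ⁻¹ᵁ U) := hU.preimage f
  have hp : (p : Γ(Z, U)) = 0 := hZ.section_eq_zero U
  let := (f.app U).hom.toAlgebra
  have : Module.Finite Γ(Z, U) Γ(Y, f ⁻¹ᵁ U) := f.finite_app U hU
  have hbij := bijective_comap_app f hU hV
  obtain ⟨n, hn⟩ := exists_pow_mem_range (A := Γ(Z, U)) (B := Γ(Y, f ⁻¹ᵁ U)) p hp hbij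
    (ringHom_ext_of_universallyInjective f hU hV)
  refine ⟨n, fun r hr => ?_⟩
  obtain ⟨ψ, hψ⟩ := exists_ringHom_comp_eq_pow (f.app U).hom
    (isDomain_of_comap_bijective (A := Γ(Z, U)) (B := Γ(Y, f ⁻¹ᵁ U)) hbij).2 p r hp (hn r hr)
  refine ⟨hU.isoSpec.hom ≫ Spec.map (CommRingCat.ofHom ψ) ≫ hV.fromSpec, ?_⟩
  have hcomp : f.app U ≫ CommRingCat.ofHom ψ = (iteratedFrobenius p Z hZ r).appLE U U
      (iteratedFrobenius_preimage p Z hZ r U).ge := by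
    ext a
    exact (hψ a).trans (iteratedFrobenius_appLE p Z hZ r U a).symm
  rw [Category.assoc, Category.assoc, ← IsAffineOpen.SpecMap_appLE_fromSpec f hU hV le_rfl,
    Scheme.Hom.appLE_eq_app, ← Spec.map_comp_assoc, hcomp,
    IsAffineOpen.SpecMap_appLE_fromSpec _ hU hU, IsAffineOpen.isoSpec_hom_fromSpec_assoc]

end Local

theorem exists_comp_eq_iteratedFrobenius {Y Z : Scheme.{u}} (p : ℕ) [Fact p.Prime]
    (hZ : HasChar p Z) [CompactSpace Z] [IsLocallyNoetherian Z] [IsNormal Z] [IsReduced Y]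
    (f : Y ⟶ Z) [IsFinite f] [Surjective f] [UniversallyInjective f] :
    ∃ (r : ℕ) (g : Z ⟶ Y), g ≫ f = iteratedFrobenius p Z hZ r := by
  have := IsNormal.isReduced (Z := Z)
  have H (z : Z) : ∃ U : Z.Opens, z ∈ U ∧ ∃ n : ℕ, ∀ r, n ≤ r →
      ∃ g : U.toScheme ⟶ Y, g ≫ f = U.ι ≫ iteratedFrobenius p Z hZ r := by
    obtain ⟨U, hz, hU, _, _⟩ := IsNormal.exists_isAffineOpen z
    exact ⟨U, hz, exists_lift_iteratedFrobenius_of_isAffineOpen f p hZ hU⟩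
  choose U hzU n hn using H
  obtain ⟨t, ht⟩ := isCompact_univ.elim_finite_subcover (fun z => (U z : Set Z))
    (fun z => (U z).isOpen) fun z _ => Set.mem_iUnion.mpr ⟨z, hzU z⟩
  refine ⟨t.sup n, exists_hom_comp_eq f _ (Z.openCoverOfIsOpenCover (fun z : t => U z) (.mk ?_))
    fun (z : t) => hn z _ (Finset.le_sup z.2)⟩
  refine eq_top_iff.mpr fun z _ => ?_
  obtain ⟨i, hi, hz⟩ := Set.mem_iUnion₂.mp (ht (Set.mem_univ z))
  exact TopologicalSpace.Opens.mem_iSup.mpr ⟨⟨i, hi⟩, hz⟩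

end FrobeniusFactor

theorem proposition4p8 (p : ℕ) [Fact p.Prime] {k : Type u} [Field k] [CharP k p] [PerfectField k]
    {Y Z : Over (Spec (.of k))}
    [LocallyOfFiniteType Y.hom] [QuasiCompact Y.hom]
    [LocallyOfFiniteType Z.hom] [QuasiCompact Z.hom]
    [AlgebraicGeometry.IsReduced Y.left] [FrobeniusFactor.IsNormal Z.left]
    (f : Y ⟶ Z) [IsProper f.left] (hf : FrobeniusFactor.BijectiveOnPoints f) :
    FrobeniusFactor.IsFrobeniusFactor p f := by
  have := hf.surjective
  have := hf.universallyInjective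
  -- Zariski's main theorem; quasi-finiteness is inferred from universal injectivity.
  have : IsFinite f.left := .of_isProper_of_locallyQuasiFinite f.left
  have : IsLocallyNoetherian Z.left := LocallyOfFiniteType.isLocallyNoetherian Z.hom
  have : CompactSpace Z.left := QuasiCompact.compactSpace_of_compactSpace Z.hom
  obtain ⟨r, g, hg⟩ := FrobeniusFactor.exists_comp_eq_iteratedFrobenius p
    (FrobeniusFactor.hasChar_of_over p Z) f.left
  have hw : g ≫ Y.hom = (FrobeniusFactor.frobeniusTwist p Z r).hom := by
    rw [← Over.w f, ← Category.assoc, hg]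
    exact Over.w (FrobeniusFactor.frobeniusPower p Z r)
  exact ⟨r, Over.homMk g hw, Over.OverMorphism.ext hg⟩
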